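/- Let $\mathbb{K}$ be a field of characteristic zero (for instance $\mathbb{R}$ or $\mathbb{C}$), let $\ell\ge 1$ and $n\geq 0$ be integers, and let $X=(x_{ij})$, $1\le i\le \ell$, $1\le j\le n$, be a matrix of independent commuting variables. The group $\mathfrak{S}_n\times GL_\ell(\mathbb{K})$ acts on $\mathbb{K}[X]$ by $(\sigma,M)\cdot g(X)=g(M^{-1}X_\sigma)$, where $X_\sigma=(x_{i\sigma(j)})_{i,j}$. For a symmetric polynomial $f\in\mathbb{K}[x_{11},\dots,x_{1n}]$ in the first row of variables, let the polarization module $\mathcal{M}_f$ generated by $f$ be the smallest $\mathbb{K}$-subspace of $\mathbb{K}[X]$ that contains $\{\sigma\cdot f : \sigma\in\mathfrak{S}_n\}$, is closed under all partial derivatives $\partial_{ij}=\partial/\partial x_{ij}$, and is closed under all generalized polarization operators $E_{i,k}^{(p)}=\sum_{j=1}^n x_{ij}\,\partial_{kj}^{\,p}$ with $1\le i,k\le \ell$ and $p\ge 1$. Let $p_d=\sum_{j=1}^n x_{1j}^d$. If $f\in\mathbb{K}[x_{11},\dots,x_{1n}]$ is a nonzero homogeneous symmetric polynomial of degree $2$,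 then $\mathcal{M}_f$ is isomorphic, as an $\mathfrak{S}_n\times GL_\ell(\mathbb{K})$-module, to $\mathcal{M}_{p_1^2}$ or to $\mathcal{M}_{p_2}$. (In particular these subspaces are stable under the action of $\mathfrak{S}_n\times GL_\ell(\mathbb{K})$.) -/

import Mathlib

open MvPolynomial

noncomputable section

namespace PolarizationModule

/-- The ring `𝕂[X]` of polynomials in the entries `x_{ij}` of an `ℓ × n` matrix of variables. -/
abbrev PolyRing (𝕂 : Type*) [Field 𝕂] (ℓ n : ℕ) : Type _ := MvPolynomial (Fin ℓ × Fin n) 𝕂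

/-- The diagonal action of a permutation: `x_{ij} ↦ x_{iσ(j)}`. -/
def columnPerm (𝕂 : Type*) [Field 𝕂] (ℓ n : ℕ) (σ : Equiv.Perm (Fin n)) :
    PolyRing 𝕂 ℓ n →ₐ[𝕂] PolyRing 𝕂 ℓ n :=
  rename fun ij => (ij.1, σ ij.2)

/-- The substitution `X ↦ A X`, that is `x_{ij} ↦ ∑ₖ a_{ik} x_{kj}`. -/
def rowSubst (𝕂 : Type*) [Field 𝕂] (ℓ n : ℕ) (A : Matrix (Fin ℓ) (Fin ℓ) 𝕂) :
    PolyRing 𝕂 ℓ n →ₐ[𝕂] PolyRing 𝕂 ℓ n :=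
  aeval fun ij => ∑ k : Fin ℓ, C (A ij.1 k) * X (k, ij.2)

theorem columnPerm_one (𝕂 : Type*) [Field 𝕂] (ℓ n : ℕ) :
    columnPerm 𝕂 ℓ n 1 = AlgHom.id 𝕂 _ := by
  ext ij : 1
  simp [columnPerm]

theorem columnPerm_mul (𝕂 : Type*) [Field 𝕂] (ℓ n : ℕ) (σ τ : Equiv.Perm (Fin n)) :
    columnPerm 𝕂 ℓ n (σ * τ) = (columnPerm 𝕂 ℓ n σ).comp (columnPerm 𝕂 ℓ n τ) := by
  ext ij : 1
  simp [columnPerm]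

theorem rowSubst_one (𝕂 : Type*) [Field 𝕂] (ℓ n : ℕ) :
    rowSubst 𝕂 ℓ n 1 = AlgHom.id 𝕂 _ := by
  ext ij : 1
  simp [rowSubst, Matrix.one_apply]

theorem rowSubst_mul (𝕂 : Type*) [Field 𝕂] (ℓ n : ℕ) (A B : Matrix (Fin ℓ) (Fin ℓ) 𝕂) :
    rowSubst 𝕂 ℓ n (A * B) = (rowSubst 𝕂 ℓ n B).comp (rowSubst 𝕂 ℓ n A) := by
  ext ij : 1
  simp only [rowSubst, aeval_X, AlgHom.comp_apply, map_sum, map_mul, algHom_C, Matrix.mul_apply,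
    Finset.mul_sum, Finset.sum_mul, MvPolynomial.algebraMap_eq]
  rw [Finset.sum_comm]
  simp only [mul_assoc]

theorem columnPerm_comm_rowSubst (𝕂 : Type*) [Field 𝕂] (ℓ n : ℕ) (σ : Equiv.Perm (Fin n))
    (A : Matrix (Fin ℓ) (Fin ℓ) 𝕂) :
    (columnPerm 𝕂 ℓ n σ).comp (rowSubst 𝕂 ℓ n A) =
      (rowSubst 𝕂 ℓ n A).comp (columnPerm 𝕂 ℓ n σ) := by
  ext ij : 1
  simp [rowSubst, columnPerm]

/-- The representation of `𝔖ₙ × GL_ℓ(𝕂)` on `𝕂[X]` given by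
`(σ, M) · f(X) = f(M⁻¹ X_σ)`, where `X_σ = (x_{iσ(j)})`. -/
def matrixRep (𝕂 : Type*) [Field 𝕂] (ℓ n : ℕ) :
    Representation 𝕂 (Equiv.Perm (Fin n) × GL (Fin ℓ) 𝕂) (PolyRing 𝕂 ℓ n) where
  toFun g := ((columnPerm 𝕂 ℓ n g.1).comp
    (rowSubst 𝕂 ℓ n (↑g.2⁻¹ : Matrix (Fin ℓ) (Fin ℓ) 𝕂))).toLinearMap
  map_one' := by
    rw [Prod.fst_one, Prod.snd_one, inv_one, Units.val_one, rowSubst_one, columnPerm_one]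
    rfl
  map_mul' g h := by
    rw [Prod.fst_mul, Prod.snd_mul, mul_inv_rev, Units.val_mul, rowSubst_mul, columnPerm_mul,
      AlgHom.comp_assoc, ← AlgHom.comp_assoc (columnPerm 𝕂 ℓ n h.1),
      columnPerm_comm_rowSubst 𝕂 ℓ n h.1, AlgHom.comp_assoc, ← AlgHom.comp_assoc]
    rfl

/-- The generalized polarization operator `E_{i,k}^{(p)} = ∑ⱼ x_{ij} ∂_{kj}^p`. -/
def polarization {𝕂 : Type*} [Field 𝕂] {ℓ n : ℕ} (i k : Fin ℓ) (p : ℕ) (g : PolyRing 𝕂 ℓ n) :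
    PolyRing 𝕂 ℓ n :=
  ∑ j : Fin n, X (i, j) * (pderiv (k, j))^[p] g

/-- A subspace is closed under derivatives if it is stable under every `∂_{ij}`. -/
def ClosedUnderDerivatives {𝕂 : Type*} [Field 𝕂] {ℓ n : ℕ}
    (V : Submodule 𝕂 (PolyRing 𝕂 ℓ n)) : Prop :=
  ∀ g ∈ V, ∀ (i : Fin ℓ) (j : Fin n), pderiv (i, j) g ∈ V

/-- A subspace is closed under polarization if it is stable under every `E_{i,k}^{(p)}`, `p ≥ 1`. -/
def ClosedUnderPolarization {𝕂 : Type*} [Field 𝕂] {ℓ n : ℕ}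
    (V : Submodule 𝕂 (PolyRing 𝕂 ℓ n)) : Prop :=
  ∀ g ∈ V, ∀ (i k : Fin ℓ) (p : ℕ), 1 ≤ p → polarization i k p g ∈ V

/-- The polarization module generated by a family `F`: the smallest subspace containing `F` that is
closed under derivatives and closed under polarization. -/
def polarizationModule {𝕂 : Type*} [Field 𝕂] {ℓ n : ℕ} (F : Set (PolyRing 𝕂 ℓ n)) :
    Submodule 𝕂 (PolyRing 𝕂 ℓ n) :=
  sInf {V | ClosedUnderDerivatives V ∧ ClosedUnderPolarization V ∧ F ⊆ V}

/-- The polynomial `f(x_{11}, …, x_{1n})` in the first row of variables. -/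
def firstRow {𝕂 : Type*} [Field 𝕂] (ℓ : ℕ) [NeZero ℓ] {n : ℕ} (f : MvPolynomial (Fin n) 𝕂) :
    PolyRing 𝕂 ℓ n :=
  rename (fun j => ((0 : Fin ℓ), j)) f

/-- The polarization module `𝓜_f` generated by the diagonal `𝔖ₙ`-orbit of `f(x_{11}, …, x_{1n})`. -/
def polarizationModuleOf {𝕂 : Type*} [Field 𝕂] (ℓ : ℕ) [NeZero ℓ] {n : ℕ}
    (f : MvPolynomial (Fin n) 𝕂) : Submodule 𝕂 (PolyRing 𝕂 ℓ n) :=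
  polarizationModule (Set.range fun σ : Equiv.Perm (Fin n) => columnPerm 𝕂 ℓ n σ (firstRow ℓ f))

/-- Two subspaces of `𝕂[X]` are isomorphic as `𝔖ₙ × GL_ℓ(𝕂)`-modules: both are stable under the
action, and there is an equivariant linear isomorphism between them. -/
def IsomorphicModules {𝕂 : Type*} [Field 𝕂] {ℓ n : ℕ}
    (V W : Submodule 𝕂 (PolyRing 𝕂 ℓ n)) : Prop :=
  ∃ V' W' : Subrepresentation (matrixRep 𝕂 ℓ n), V'.toSubmodule = V ∧ W'.toSubmodule = W ∧
    Nonempty (V'.toRepresentation.Equiv W'.toRepresentation)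

end PolarizationModule

end

/-! A symmetric quadratic form is `a p₁² + b p₂` (`exists_eq_quadSymm`), so only two parameters
matter. Except when both `a + b` and `n a + b` vanish, its module is the explicit space `quadSpan ℓ
n a b` (`polarizationModuleOf_quadSymm`): the full polarizations of the form, the row sums, the
constants, and `b` times each variable.

If the form is a multiple of `p₁²`, rescaling the generator changes nothing. Otherwise `b ≠ 0` and
`n ≥ 2`, and the two degenerate conditions cannot both hold. An equivariant operator `S`
(`quadSplit`) kills degrees 0 and 1 and turns the polarizations of `p₂` into those of `p₁²`, so `b •
id + a • S` maps the module of `p₂` onto that of the form (`quadSpan_map`). It is injective because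
mixed derivatives in two distinct columns vanish on the module of `p₂` but detect the image of `S`
(`isomorphicModules_quadSpan`). -/

namespace PolarizationModule

/-! ### The explicit span and its closure properties -/

noncomputable section QuadraticSpan

variable {𝕂 : Type*} [Field 𝕂] {ℓ n : ℕ}

/-- The sum `∑ⱼ x_{ij}` of the variables in row `i`. -/
def rowSum (𝕂 : Type*) [Field 𝕂] {ℓ : ℕ} (n : ℕ) (i : Fin ℓ) : PolyRing 𝕂 ℓ n :=
  ∑ j : Fin n, X (i, j)

/-- The quadratic form `a (∑ⱼ x_{ij}) (∑ⱼ x_{kj}) + b ∑ⱼ x_{ij} x_{kj}`. -/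
def quad (n : ℕ) (a b : 𝕂) (i k : Fin ℓ) : PolyRing 𝕂 ℓ n :=
  a • (rowSum 𝕂 n i * rowSum 𝕂 n k) + b • ∑ j : Fin n, X (i, j) * X (k, j)

/-- The subspace spanned by `1`, the row sums, the `b x_{ij}` and the forms `quad n a b i k`. -/
def quadSpan (ℓ n : ℕ) (a b : 𝕂) : Submodule 𝕂 (PolyRing 𝕂 ℓ n) :=
  Submodule.span 𝕂 ({1} ∪ Set.range (rowSum 𝕂 n) ∪
    Set.range (fun ij : Fin ℓ × Fin n => b • (X ij : PolyRing 𝕂 ℓ n)) ∪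
    Set.range (fun ik : Fin ℓ × Fin ℓ => quad n a b ik.1 ik.2))

theorem one_mem_quadSpan (a b : 𝕂) : (1 : PolyRing 𝕂 ℓ n) ∈ quadSpan ℓ n a b :=
  Submodule.subset_span (by simp)

theorem rowSum_mem_quadSpan (a b : 𝕂) (i : Fin ℓ) : rowSum 𝕂 n i ∈ quadSpan ℓ n a b :=
  Submodule.subset_span (by simp)

/-- Keeping the factor `b` lets one family cover both types: at `b = 0` these generators vanish, and
otherwise they give every variable. -/
theorem smul_X_mem_quadSpan (a b : 𝕂) (ij : Fin ℓ × Fin n) :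
    b • (X ij : PolyRing 𝕂 ℓ n) ∈ quadSpan ℓ n a b :=
  Submodule.subset_span (Or.inl (Or.inr ⟨ij, rfl⟩))

theorem quad_mem_quadSpan (a b : 𝕂) (i k : Fin ℓ) :
    quad n a b i k ∈ quadSpan ℓ n a b :=
  Submodule.subset_span (Or.inr ⟨(i, k), rfl⟩)

theorem quadSpan_le_iff {a b : 𝕂} {V : Submodule 𝕂 (PolyRing 𝕂 ℓ n)} :
    quadSpan ℓ n a b ≤ V ↔ 1 ∈ V ∧ (∀ i, rowSum 𝕂 n i ∈ V) ∧
      (∀ ij : Fin ℓ × Fin n, b • (X ij : PolyRing 𝕂 ℓ n) ∈ V) ∧ ∀ i k, quad n a b i k ∈ V := by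
  simp only [quadSpan, Submodule.span_le, Set.union_subset_iff, Set.singleton_subset_iff,
    Set.range_subset_iff, SetLike.mem_coe, Prod.forall, and_assoc]

theorem quad_comm (a b : 𝕂) (i k : Fin ℓ) : quad n a b i k = quad n a b k i := by
  simp only [quad, mul_comm]

theorem pderiv_rowSum (i k : Fin ℓ) (j : Fin n) :
    pderiv (k, j) (rowSum 𝕂 n i) = if i = k then 1 else 0 := by
  simp only [rowSum, map_sum, pderiv_X, Pi.single_apply, Prod.mk.injEq]
  by_cases h : i = k
  · simp [h]
  · simp [h]

theorem pderiv_quad (a b : 𝕂) (i k m : Fin ℓ) (j : Fin n) :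
    pderiv (m, j) (quad n a b i k) =
      (if i = m then a • rowSum 𝕂 n k + b • X (k, j) else 0) +
        if k = m then a • rowSum 𝕂 n i + b • X (i, j) else 0 := by
  have hX : ∀ (i : Fin ℓ) (t : Fin n), pderiv (m, j) (X (i, t) : PolyRing 𝕂 ℓ n) =
      if i = m then (if t = j then 1 else 0) else 0 := by
    intro i t
    rw [pderiv_X, Pi.single_apply]
    by_cases h : i = m <;> by_cases h' : t = j <;> simp [h, h']
  simp only [quad, map_add, Derivation.map_smul, Derivation.leibniz, pderiv_rowSum, map_sum, hX,
    smul_eq_mul]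
  by_cases h : i = m <;> by_cases h' : k = m <;> simp [h, h', Finset.sum_add_distrib, smul_add]
  abel

theorem pderiv_pderiv_quad (a b : 𝕂) (i k m : Fin ℓ) (j : Fin n) :
    pderiv (m, j) (pderiv (m, j) (quad n a b i k)) =
      if i = m ∧ k = m then C (2 * (a + b)) else 0 := by
  rw [pderiv_quad]
  by_cases h : i = m <;> by_cases h' : k = m <;>
    simp [h, h', pderiv_rowSum, smul_eq_C_mul]
  rw [show (C (2 : 𝕂) : PolyRing 𝕂 ℓ n) = 2 from map_ofNat C 2]
  ring

theorem iterate_pderiv_eq_zero {s : Fin ℓ × Fin n} {g : PolyRing 𝕂 ℓ n} {m : ℕ}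
    (h : (pderiv s)^[m] g = 0) {p : ℕ} (hp : m ≤ p) : (pderiv s)^[p] g = 0 := by
  obtain ⟨q, rfl⟩ := Nat.exists_eq_add_of_le' hp
  rw [Function.iterate_add_apply, h, iterate_map_zero]

/-- The operator `E_{i,k}^{(p)}` as a linear map. -/
def polarizationLinear (i k : Fin ℓ) (p : ℕ) : PolyRing 𝕂 ℓ n →ₗ[𝕂] PolyRing 𝕂 ℓ n where
  toFun := polarization i k p
  map_add' f g := by
    simp only [polarization, iterate_map_add, mul_add, Finset.sum_add_distrib]
  map_smul' c f := by
    have h : ∀ j : Fin n, (pderiv (k, j))^[p] (c • f) = c • (pderiv (k, j))^[p] f := fun j =>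
      Function.Commute.iterate_left (g := fun f : PolyRing 𝕂 ℓ n => c • f)
        (fun f => (pderiv (k, j)).map_smul c f) p f
    simp only [polarization, h, mul_smul_comm, Finset.smul_sum, RingHom.id_apply]

theorem polarization_one_rowSum (i k m : Fin ℓ) :
    polarization i k 1 (rowSum 𝕂 n m) = if m = k then rowSum 𝕂 n i else 0 := by
  simp only [polarization, Function.iterate_one, pderiv_rowSum]
  split_ifs <;> simp [rowSum]

theorem polarization_one_X (i k : Fin ℓ) (s : Fin ℓ × Fin n) :
    polarization i k 1 (X s : PolyRing 𝕂 ℓ n) = if s.1 = k then X (i, s.2) else 0 := by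
  obtain ⟨m, t⟩ := s
  simp only [polarization, Function.iterate_one, pderiv_X, Pi.single_apply, Prod.mk.injEq]
  by_cases h : m = k <;> simp [h]

theorem polarization_one_quad (a b : 𝕂) (i k m r : Fin ℓ) :
    polarization i k 1 (quad n a b m r) =
      (if m = k then quad n a b i r else 0) + if r = k then quad n a b m i else 0 := by
  have h : ∀ r : Fin ℓ, ∑ j : Fin n, X (i, j) * (a • rowSum 𝕂 n r + b • X (r, j)) =
      quad n a b i r := fun r => by
    simp only [mul_add, Finset.sum_add_distrib, mul_smul_comm, ← Finset.smul_sum,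
      ← Finset.sum_mul, quad, rowSum]
  simp only [polarization, Function.iterate_one, pderiv_quad, mul_add, Finset.sum_add_distrib]
  congr 1
  · split_ifs
    · rw [← h]
    · simp
  · split_ifs
    · rw [quad_comm, ← h]
    · simp

theorem polarization_two_quad (a b : 𝕂) (i k m r : Fin ℓ) :
    polarization i k 2 (quad n a b m r) =
      if m = k ∧ r = k then (2 * (a + b)) • rowSum 𝕂 n i else 0 := by
  simp only [polarization, Function.iterate_succ, Function.iterate_zero, Function.comp_apply, id,
    pderiv_pderiv_quad]
  split_ifs
  · rw [rowSum, smul_eq_C_mul, ← Finset.sum_mul, mul_comm]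
  · simp

theorem closedUnderDerivatives_quadSpan (a b : 𝕂) :
    ClosedUnderDerivatives (quadSpan ℓ n a b) := by
  intro g hg i j
  revert g
  change quadSpan ℓ n a b ≤ (quadSpan ℓ n a b).comap (pderiv (i, j)).toLinearMap
  have h1 := one_mem_quadSpan (ℓ := ℓ) (n := n) a b
  have h2 : ∀ k, a • rowSum 𝕂 n k + b • X (k, j) ∈ quadSpan ℓ n a b := fun k =>
    add_mem (Submodule.smul_mem _ _ (rowSum_mem_quadSpan a b k)) (smul_X_mem_quadSpan a b _)
  refine quadSpan_le_iff.2 ⟨?_, fun k => ?_, fun s => ?_, fun k m => ?_⟩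
  · simp
  · change pderiv (i, j) (rowSum 𝕂 n k) ∈ quadSpan ℓ n a b
    rw [pderiv_rowSum]
    split_ifs
    exacts [h1, zero_mem _]
  · change pderiv (i, j) (b • X s) ∈ quadSpan ℓ n a b
    rw [Derivation.map_smul, pderiv_X, Pi.single_apply]
    split_ifs
    exacts [Submodule.smul_mem _ _ h1, by simp]
  · change pderiv (i, j) (quad n a b k m) ∈ quadSpan ℓ n a b
    rw [pderiv_quad]
    refine add_mem ?_ ?_ <;> split_ifs
    exacts [h2 _, zero_mem _, h2 _, zero_mem _]

theorem closedUnderPolarization_quadSpan (a b : 𝕂) :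
    ClosedUnderPolarization (quadSpan ℓ n a b) := by
  intro g hg i k p hp
  revert g
  change quadSpan ℓ n a b ≤ (quadSpan ℓ n a b).comap (polarizationLinear i k p)
  -- Each generator is killed by `∂^m` once `m` exceeds its degree, leaving only `p = 1` for linear
  -- forms and `p = 1, 2` for quadratic ones.
  have hz : ∀ {g : PolyRing 𝕂 ℓ n} {m : ℕ}, (∀ j, (pderiv (k, j))^[m] g = 0) → m ≤ p →
      polarization i k p g ∈ quadSpan ℓ n a b := fun h hm => by
    rw [polarization, Finset.sum_eq_zero]
    · exact zero_mem _
    · intro j _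
      rw [iterate_pderiv_eq_zero (h j) hm, mul_zero]
  refine quadSpan_le_iff.2 ⟨?_, fun m => ?_, fun s => ?_, fun m r => ?_⟩
  · exact hz (m := 1) (fun j => by simp) hp
  · change polarization i k p (rowSum 𝕂 n m) ∈ quadSpan ℓ n a b
    obtain rfl | hp := hp.eq_or_lt
    · rw [polarization_one_rowSum]
      split_ifs
      exacts [rowSum_mem_quadSpan a b i, zero_mem _]
    · refine hz (m := 2) (fun j => ?_) hp
      simp only [Function.iterate_succ, Function.iterate_zero, Function.comp_apply, id,
        pderiv_rowSum]
      split_ifs <;> simp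
  · rw [Submodule.mem_comap, map_smul]
    change b • polarization i k p (X s) ∈ quadSpan ℓ n a b
    obtain rfl | hp := hp.eq_or_lt
    · rw [polarization_one_X]
      split_ifs
      exacts [smul_X_mem_quadSpan a b _, by simp]
    · refine Submodule.smul_mem _ _ (hz (m := 2) (fun j => ?_) hp)
      simp only [Function.iterate_succ, Function.iterate_zero, Function.comp_apply, id,
        pderiv_X, Pi.single_apply]
      split_ifs <;> simp
  · change polarization i k p (quad n a b m r) ∈ quadSpan ℓ n a b
    obtain rfl | hp := hp.eq_or_lt
    · rw [polarization_one_quad]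
      refine add_mem ?_ ?_ <;> split_ifs
      exacts [quad_mem_quadSpan a b _ _, zero_mem _, quad_mem_quadSpan a b _ _, zero_mem _]
    obtain rfl | hp := (Nat.succ_le_of_lt hp).eq_or_lt
    · rw [polarization_two_quad]
      split_ifs
      exacts [Submodule.smul_mem _ _ (rowSum_mem_quadSpan a b i), zero_mem _]
    · refine hz (m := 3) (fun j => ?_) hp
      simp only [Function.iterate_succ, Function.iterate_zero, Function.comp_apply, id,
        pderiv_pderiv_quad]
      split_ifs <;> simp

/-! ### Stability under the group action -/

theorem columnPerm_rowSum (σ : Equiv.Perm (Fin n)) (i : Fin ℓ) :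
    columnPerm 𝕂 ℓ n σ (rowSum 𝕂 n i) = rowSum 𝕂 n i := by
  simp only [columnPerm, rowSum, map_sum, rename_X]
  exact Equiv.sum_comp σ fun j => (X (i, j) : PolyRing 𝕂 ℓ n)

theorem columnPerm_quad (σ : Equiv.Perm (Fin n)) (a b : 𝕂) (i k : Fin ℓ) :
    columnPerm 𝕂 ℓ n σ (quad n a b i k) = quad n a b i k := by
  simp only [quad, map_add, map_smul, map_mul, columnPerm_rowSum]
  congr 2
  simp only [columnPerm, map_sum, map_mul, rename_X]
  exact Equiv.sum_comp σ fun j => (X (i, j) * X (k, j) : PolyRing 𝕂 ℓ n)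

theorem rowSubst_rowSum (A : Matrix (Fin ℓ) (Fin ℓ) 𝕂) (i : Fin ℓ) :
    rowSubst 𝕂 ℓ n A (rowSum 𝕂 n i) = ∑ k, A i k • rowSum 𝕂 n k := by
  simp only [rowSubst, rowSum, map_sum, aeval_X, smul_eq_C_mul, Finset.mul_sum]
  exact Finset.sum_comm

theorem rowSubst_quad (A : Matrix (Fin ℓ) (Fin ℓ) 𝕂) (a b : 𝕂) (i k : Fin ℓ) :
    rowSubst 𝕂 ℓ n A (quad n a b i k) = ∑ m, ∑ r, (A i m * A k r) • quad n a b m r := by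
  have hX : ∀ (i : Fin ℓ) (j : Fin n), rowSubst 𝕂 ℓ n A (X (i, j)) = ∑ m, A i m • X (m, j) :=
    fun i j => by simp [rowSubst, smul_eq_C_mul]
  simp only [quad, map_add, map_smul, map_mul, rowSubst_rowSum, map_sum, hX, Finset.sum_mul_sum,
    smul_mul_smul_comm, smul_add, Finset.sum_add_distrib, Finset.smul_sum]
  congr 1
  · simp only [smul_comm a]
  · rw [Finset.sum_comm]
    refine Finset.sum_congr rfl fun m _ => ?_
    rw [Finset.sum_comm]
    simp only [smul_comm b]

theorem matrixRep_apply (g : Equiv.Perm (Fin n) × GL (Fin ℓ) 𝕂) (v : PolyRing 𝕂 ℓ n) :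
    matrixRep 𝕂 ℓ n g v =
      columnPerm 𝕂 ℓ n g.1 (rowSubst 𝕂 ℓ n (↑g.2⁻¹ : Matrix (Fin ℓ) (Fin ℓ) 𝕂) v) :=
  rfl

theorem columnPerm_mem_quadSpan (a b : 𝕂) (σ : Equiv.Perm (Fin n)) {v : PolyRing 𝕂 ℓ n}
    (hv : v ∈ quadSpan ℓ n a b) : columnPerm 𝕂 ℓ n σ v ∈ quadSpan ℓ n a b := by
  revert v
  change quadSpan ℓ n a b ≤ (quadSpan ℓ n a b).comap (columnPerm 𝕂 ℓ n σ).toLinearMap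
  simp only [quadSpan_le_iff, Submodule.mem_comap, AlgHom.toLinearMap_apply, map_one, map_smul,
    columnPerm_rowSum, columnPerm_quad]
  refine ⟨one_mem_quadSpan a b, rowSum_mem_quadSpan a b, fun s => ?_, quad_mem_quadSpan a b⟩
  rw [columnPerm, rename_X]
  exact smul_X_mem_quadSpan a b _

theorem rowSubst_mem_quadSpan (a b : 𝕂) (A : Matrix (Fin ℓ) (Fin ℓ) 𝕂) {v : PolyRing 𝕂 ℓ n}
    (hv : v ∈ quadSpan ℓ n a b) : rowSubst 𝕂 ℓ n A v ∈ quadSpan ℓ n a b := by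
  revert v
  change quadSpan ℓ n a b ≤ (quadSpan ℓ n a b).comap (rowSubst 𝕂 ℓ n A).toLinearMap
  simp only [quadSpan_le_iff, Submodule.mem_comap, AlgHom.toLinearMap_apply, map_one, map_smul,
    rowSubst_rowSum, rowSubst_quad]
  refine ⟨one_mem_quadSpan a b, fun i => ?_, fun s => ?_, fun i k => ?_⟩
  · exact sum_mem fun k _ => Submodule.smul_mem _ _ (rowSum_mem_quadSpan a b k)
  · rw [rowSubst, aeval_X, Finset.smul_sum]
    refine sum_mem fun k _ => ?_
    rw [← smul_eq_C_mul, smul_comm]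
    exact Submodule.smul_mem _ _ (smul_X_mem_quadSpan a b _)
  · exact sum_mem fun m _ => sum_mem fun r _ =>
      Submodule.smul_mem _ _ (quad_mem_quadSpan a b m r)

/-- `quadSpan ℓ n a b` as a subrepresentation of `𝕂[X]`. -/
def quadSubrep (ℓ n : ℕ) (a b : 𝕂) : Subrepresentation (matrixRep 𝕂 ℓ n) where
  toSubmodule := quadSpan ℓ n a b
  apply_mem_toSubmodule g _ hv := by
    rw [matrixRep_apply]
    exact columnPerm_mem_quadSpan a b _ (rowSubst_mem_quadSpan a b _ hv)

/-! ### Computation of the polarization module -/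

/-- The symmetric quadratic polynomial `a p₁² + b p₂`. -/
def quadSymm (n : ℕ) (a b : 𝕂) : MvPolynomial (Fin n) 𝕂 :=
  a • psum (Fin n) 𝕂 1 ^ 2 + b • psum (Fin n) 𝕂 2

theorem firstRow_quadSymm [NeZero ℓ] (a b : 𝕂) :
    firstRow ℓ (quadSymm n a b) = quad n a b (0 : Fin ℓ) 0 := by
  simp [firstRow, quadSymm, quad, psum, rowSum, sq]

theorem quadSpan_le_of_closed [CharZero 𝕂] [NeZero ℓ] {a b : 𝕂} (hn : n ≠ 0)
    (hab : a + b ≠ 0 ∨ n * a + b ≠ 0) {V : Submodule 𝕂 (PolyRing 𝕂 ℓ n)}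
    (hd : ClosedUnderDerivatives V) (hp : ClosedUnderPolarization V)
    (h0 : quad n a b (0 : Fin ℓ) 0 ∈ V) : quadSpan ℓ n a b ≤ V := by
  -- `E_{i,0}^{(1)}` replaces one row index 0 by `i`; both slots contribute equally, hence the
  -- factor 2.
  have hF0 : ∀ i, quad n a b i (0 : Fin ℓ) ∈ V := fun i => by
    have h := hp _ h0 i 0 1 le_rfl
    rw [polarization_one_quad, if_pos rfl, if_pos rfl, quad_comm a b 0 i, ← two_smul 𝕂] at h
    exact (V.smul_mem_iff two_ne_zero).1 h
  have hF : ∀ i k, quad n a b i k ∈ V := fun i k => by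
    have h := hp _ (hF0 i) k 0 1 le_rfl
    rw [polarization_one_quad, if_pos rfl] at h
    refine (V.add_mem_iff_right ?_).1 h
    split_ifs
    exacts [hF0 k, zero_mem _]
  have hL : ∀ i j, a • rowSum 𝕂 n i + b • X (i, j) ∈ V := fun i j => by
    have h := hd _ (hF i i) i j
    rw [pderiv_quad, if_pos rfl, ← two_smul 𝕂] at h
    exact (V.smul_mem_iff two_ne_zero).1 h
  have hP : ∀ i, rowSum 𝕂 n i ∈ V := fun i => by
    -- Two sources of row sums: `E_{i,i}^{(2)}` on the form yields the factor `2(a + b)`, and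
    -- summing its halved first derivatives over the columns yields `n a + b`.
    obtain h | h := hab
    · have h' := hp _ (hF i i) i i 2 one_le_two
      rw [polarization_two_quad, if_pos ⟨rfl, rfl⟩] at h'
      exact (V.smul_mem_iff (mul_ne_zero two_ne_zero h)).1 h'
    · have h' : ∑ j : Fin n, (a • rowSum 𝕂 n i + b • X (i, j)) ∈ V := sum_mem fun j _ => hL i j
      rw [Finset.sum_add_distrib, Finset.sum_const, Finset.card_univ, Fintype.card_fin,
        ← Finset.smul_sum, ← rowSum, ← Nat.cast_smul_eq_nsmul 𝕂, smul_smul, ← add_smul] at h'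
      exact (V.smul_mem_iff h).1 h'
  refine quadSpan_le_iff.2 ⟨?_, hP, fun ij => ?_, hF⟩
  · have h := hd _ (hP 0) 0 ⟨0, Nat.pos_of_ne_zero hn⟩
    rwa [pderiv_rowSum, if_pos rfl] at h
  · exact (V.add_mem_iff_right (V.smul_mem a (hP ij.1))).1 (hL ij.1 ij.2)

theorem polarizationModuleOf_quadSymm [CharZero 𝕂] [NeZero ℓ] {a b : 𝕂} (hn : n ≠ 0)
    (hab : a + b ≠ 0 ∨ n * a + b ≠ 0) :
    polarizationModuleOf ℓ (quadSymm n a b) = quadSpan ℓ n a b := by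
  refine le_antisymm (sInf_le ⟨closedUnderDerivatives_quadSpan a b,
    closedUnderPolarization_quadSpan a b, ?_⟩) (le_sInf fun V hV => ?_)
  · rintro _ ⟨σ, rfl⟩
    rw [firstRow_quadSymm]
    exact columnPerm_mem_quadSpan a b σ (quad_mem_quadSpan a b 0 0)
  · refine quadSpan_le_of_closed hn hab hV.1 hV.2.1 (hV.2.2 ⟨1, ?_⟩)
    simp [columnPerm_one, firstRow_quadSymm]

end QuadraticSpan

/-! ### Equivariant comparison with the module of `p₂` -/

noncomputable section Isomorphism

variable {𝕂 : Type*} [Field 𝕂] {ℓ n : ℕ}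

/-- An equivariant endomorphism of `𝕂[X]` that is injective on a subrepresentation `V` identifies
`V` with its image. -/
theorem isomorphicModules_of_map {V W : Subrepresentation (matrixRep 𝕂 ℓ n)}
    (φ : PolyRing 𝕂 ℓ n →ₗ[𝕂] PolyRing 𝕂 ℓ n)
    (hφ : ∀ g v, φ (matrixRep 𝕂 ℓ n g v) = matrixRep 𝕂 ℓ n g (φ v))
    (hinj : ∀ v ∈ V.toSubmodule, φ v = 0 → v = 0) (hmap : V.toSubmodule.map φ = W.toSubmodule) :
    IsomorphicModules V.toSubmodule W.toSubmodule := by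
  have hmem : ∀ v ∈ V.toSubmodule, φ v ∈ W.toSubmodule := fun v hv =>
    hmap ▸ Submodule.mem_map_of_mem hv
  let e : V.toSubmodule ≃ₗ[𝕂] W.toSubmodule := LinearEquiv.ofBijective (φ.restrict hmem) <| by
    refine ⟨(injective_iff_map_eq_zero _).2 fun v hv => ?_, fun w => ?_⟩
    · exact Subtype.ext (hinj v v.2 (congrArg Subtype.val hv))
    · obtain ⟨v, hv, hvw⟩ := hmap.ge w.2
      exact ⟨⟨v, hv⟩, Subtype.ext hvw⟩
  exact ⟨V, W, rfl, rfl, ⟨Representation.Equiv.mk e fun g =>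
    LinearMap.ext fun v => Subtype.ext (hφ g v)⟩⟩

/-- The substitution `x_{ij} ↦ c ∑ₘ x_{im}`. -/
def rowSumSubst (𝕂 : Type*) [Field 𝕂] (ℓ n : ℕ) (c : 𝕂) : PolyRing 𝕂 ℓ n →ₐ[𝕂] PolyRing 𝕂 ℓ n :=
  aeval fun ij => c • rowSum 𝕂 n ij.1

theorem rowSumSubst_X (c : 𝕂) (ij : Fin ℓ × Fin n) :
    rowSumSubst 𝕂 ℓ n c (X ij) = c • rowSum 𝕂 n ij.1 :=
  aeval_X _ _

theorem rowSumSubst_columnPerm (c : 𝕂) (σ : Equiv.Perm (Fin n)) (v : PolyRing 𝕂 ℓ n) :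
    rowSumSubst 𝕂 ℓ n c (columnPerm 𝕂 ℓ n σ v) = columnPerm 𝕂 ℓ n σ (rowSumSubst 𝕂 ℓ n c v) := by
  suffices h : (rowSumSubst 𝕂 ℓ n c).comp (columnPerm 𝕂 ℓ n σ) =
      (columnPerm 𝕂 ℓ n σ).comp (rowSumSubst 𝕂 ℓ n c) from AlgHom.congr_fun h v
  ext1 ij
  simp only [AlgHom.comp_apply, rowSumSubst_X, map_smul, columnPerm_rowSum]
  rw [columnPerm, rename_X, rowSumSubst_X]

theorem rowSumSubst_rowSubst (c : 𝕂) (A : Matrix (Fin ℓ) (Fin ℓ) 𝕂) (v : PolyRing 𝕂 ℓ n) :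
    rowSumSubst 𝕂 ℓ n c (rowSubst 𝕂 ℓ n A v) = rowSubst 𝕂 ℓ n A (rowSumSubst 𝕂 ℓ n c v) := by
  suffices h : (rowSumSubst 𝕂 ℓ n c).comp (rowSubst 𝕂 ℓ n A) =
      (rowSubst 𝕂 ℓ n A).comp (rowSumSubst 𝕂 ℓ n c) from AlgHom.congr_fun h v
  ext1 ij
  simp only [AlgHom.comp_apply, rowSumSubst_X, map_smul, rowSubst_rowSum]
  rw [rowSubst, aeval_X, map_sum, Finset.smul_sum]
  refine Finset.sum_congr rfl fun k _ => ?_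
  rw [← smul_eq_C_mul, map_smul, rowSumSubst_X, smul_comm]

theorem rowSumSubst_matrixRep (c : 𝕂) (g : Equiv.Perm (Fin n) × GL (Fin ℓ) 𝕂)
    (v : PolyRing 𝕂 ℓ n) :
    rowSumSubst 𝕂 ℓ n c (matrixRep 𝕂 ℓ n g v) = matrixRep 𝕂 ℓ n g (rowSumSubst 𝕂 ℓ n c v) := by
  rw [matrixRep_apply, matrixRep_apply, rowSumSubst_columnPerm, rowSumSubst_rowSubst]

/-- An equivariant operator that kills `1` and all linear forms, and sends `∑ⱼ x_{ij} x_{kj}` to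
`(∑ⱼ x_{ij}) (∑ⱼ x_{kj})`. -/
def quadSplit (𝕂 : Type*) [Field 𝕂] (ℓ n : ℕ) : PolyRing 𝕂 ℓ n →ₗ[𝕂] PolyRing 𝕂 ℓ n :=
  -- In degree `d` the combination has weight `1 + (-1)^d - 2·0^d`, which is 0, 0, 2 for `d = 0, 1,
  -- 2`. The substitution turns each of the `n` terms of `∑ⱼ x_{ij} x_{kj}` into the same product of
  -- row sums, whence `2n`.
  (2 * n : 𝕂)⁻¹ • ((rowSumSubst 𝕂 ℓ n 1).toLinearMap + (rowSumSubst 𝕂 ℓ n (-1)).toLinearMap -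
    (2 : 𝕂) • (rowSumSubst 𝕂 ℓ n 0).toLinearMap)

theorem quadSplit_apply (v : PolyRing 𝕂 ℓ n) :
    quadSplit 𝕂 ℓ n v = (2 * n : 𝕂)⁻¹ • (rowSumSubst 𝕂 ℓ n 1 v + rowSumSubst 𝕂 ℓ n (-1) v -
      (2 : 𝕂) • rowSumSubst 𝕂 ℓ n 0 v) :=
  rfl

theorem quadSplit_one : quadSplit 𝕂 ℓ n 1 = 0 := by
  rw [quadSplit_apply, map_one, map_one, map_one, two_smul, sub_self, smul_zero]

theorem quadSplit_X (ij : Fin ℓ × Fin n) : quadSplit 𝕂 ℓ n (X ij) = 0 := by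
  simp [quadSplit_apply, rowSumSubst_X]

theorem quadSplit_rowSum (i : Fin ℓ) : quadSplit 𝕂 ℓ n (rowSum 𝕂 n i) = 0 := by
  rw [rowSum, map_sum]
  exact Finset.sum_eq_zero fun j _ => quadSplit_X _

theorem quadSplit_quad [CharZero 𝕂] (hn : n ≠ 0) (i k : Fin ℓ) :
    quadSplit 𝕂 ℓ n (quad n 0 1 i k) = quad n 1 0 i k := by
  have h : (n : 𝕂) ≠ 0 := Nat.cast_ne_zero.2 hn
  simp only [quad, zero_smul, one_smul, zero_add, add_zero, map_sum, quadSplit_apply, map_mul,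
    rowSumSubst_X, smul_mul_smul_comm, Finset.sum_const, Finset.card_univ, Fintype.card_fin,
    mul_zero, mul_one, mul_neg, neg_neg, smul_zero, sub_zero]
  rw [← two_smul 𝕂, ← Nat.cast_smul_eq_nsmul 𝕂, smul_smul, smul_smul,
    show (n : 𝕂) * (2 * n : 𝕂)⁻¹ * 2 = 1 by field_simp, one_smul]

theorem quadSplit_matrixRep (g : Equiv.Perm (Fin n) × GL (Fin ℓ) 𝕂) (v : PolyRing 𝕂 ℓ n) :
    quadSplit 𝕂 ℓ n (matrixRep 𝕂 ℓ n g v) = matrixRep 𝕂 ℓ n g (quadSplit 𝕂 ℓ n v) := by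
  simp only [quadSplit_apply, rowSumSubst_matrixRep, map_smul, map_add, map_sub]

/-- The operator `∑ᵢₖ (∑ₜ x_{it}) (∑ₜ x_{kt}) ∂_{ij} ∂_{km}`. -/
def mixedOperator (𝕂 : Type*) [Field 𝕂] (ℓ : ℕ) {n : ℕ} (j m : Fin n) :
    PolyRing 𝕂 ℓ n →ₗ[𝕂] PolyRing 𝕂 ℓ n :=
  ∑ i : Fin ℓ, ∑ k : Fin ℓ, LinearMap.mulLeft 𝕂 (rowSum 𝕂 n i * rowSum 𝕂 n k) ∘ₗ
    (pderiv (i, j)).toLinearMap ∘ₗ (pderiv (k, m)).toLinearMap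

theorem mixedOperator_apply (j m : Fin n) (v : PolyRing 𝕂 ℓ n) :
    mixedOperator 𝕂 ℓ j m v = ∑ i : Fin ℓ, ∑ k : Fin ℓ,
      rowSum 𝕂 n i * rowSum 𝕂 n k * pderiv (i, j) (pderiv (k, m) v) := by
  simp [mixedOperator, LinearMap.sum_apply, mul_assoc]

theorem mixedOperator_one (j m : Fin n) : mixedOperator 𝕂 ℓ j m 1 = 0 := by
  simp [mixedOperator_apply]

theorem mixedOperator_X (j m : Fin n) (s : Fin ℓ × Fin n) : mixedOperator 𝕂 ℓ j m (X s) = 0 := by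
  have h : ∀ i k : Fin ℓ, pderiv (i, j) (pderiv (k, m) (X s : PolyRing 𝕂 ℓ n)) = 0 := by
    intro i k
    rw [pderiv_X, Pi.single_apply]
    split_ifs <;> simp
  simp only [mixedOperator_apply, h, mul_zero, Finset.sum_const_zero]

theorem mixedOperator_rowSum (j m : Fin n) (i : Fin ℓ) :
    mixedOperator 𝕂 ℓ j m (rowSum 𝕂 n i) = 0 := by
  rw [rowSum, map_sum]
  exact Finset.sum_eq_zero fun _ _ => mixedOperator_X _ _ _

/-- For distinct columns the mixed derivatives do not see `∑ⱼ x_{rj} x_{sj}`, so only the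
coefficient `a` survives; multiplying back by row sums rebuilds the product. -/
theorem mixedOperator_quad {j m : Fin n} (hjm : j ≠ m) (a b : 𝕂) (r s : Fin ℓ) :
    mixedOperator 𝕂 ℓ j m (quad n a b r s) = (2 * a) • quad n 1 0 r s := by
  have h : ∀ i k : Fin ℓ, pderiv (i, j) (pderiv (k, m) (quad n a b r s)) =
      (if r = k then (if s = i then C a else 0) else 0) +
        if s = k then (if r = i then C a else 0) else 0 := by
    have hX : ∀ i s : Fin ℓ, pderiv (i, j) (X (s, m) : PolyRing 𝕂 ℓ n) = 0 := fun i s =>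
      pderiv_X_of_ne fun h => hjm (Prod.ext_iff.1 h).2.symm
    intro i k
    rw [pderiv_quad]
    by_cases h1 : r = k <;> by_cases h2 : s = k <;>
      simp [h1, h2, hX, pderiv_rowSum, smul_eq_C_mul]
  simp only [mixedOperator_apply, h, mul_add, Finset.sum_add_distrib, mul_ite, mul_zero,
    Finset.sum_ite_eq, Finset.mem_univ, if_true]
  simp only [quad, smul_eq_C_mul, zero_smul, add_zero, C_mul, map_one, one_mul,
    show (C (2 : 𝕂) : PolyRing 𝕂 ℓ n) = 2 from map_ofNat C 2]
  ring

theorem mixedOperator_eq_zero {j m : Fin n} (hjm : j ≠ m) {v : PolyRing 𝕂 ℓ n}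
    (hv : v ∈ quadSpan ℓ n (0 : 𝕂) 1) : mixedOperator 𝕂 ℓ j m v = 0 := by
  suffices h : quadSpan ℓ n (0 : 𝕂) 1 ≤ LinearMap.ker (mixedOperator 𝕂 ℓ j m) from h hv
  simp only [quadSpan_le_iff, LinearMap.mem_ker, one_smul, mixedOperator_one, mixedOperator_X,
    mixedOperator_rowSum, mixedOperator_quad hjm, mul_zero, zero_smul, implies_true, and_self]

theorem mixedOperator_quadSplit [CharZero 𝕂] {j m : Fin n} (hjm : j ≠ m) {v : PolyRing 𝕂 ℓ n}
    (hv : v ∈ quadSpan ℓ n (0 : 𝕂) 1) :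
    mixedOperator 𝕂 ℓ j m (quadSplit 𝕂 ℓ n v) = (2 : 𝕂) • quadSplit 𝕂 ℓ n v := by
  suffices h : quadSpan ℓ n (0 : 𝕂) 1 ≤ LinearMap.eqLocus
      (mixedOperator 𝕂 ℓ j m ∘ₗ quadSplit 𝕂 ℓ n) ((2 : 𝕂) • quadSplit 𝕂 ℓ n) from h hv
  have hn : n ≠ 0 := j.pos.ne'
  simp only [quadSpan_le_iff, LinearMap.mem_eqLocus, LinearMap.comp_apply, LinearMap.smul_apply,
    one_smul, quadSplit_one, quadSplit_X, quadSplit_rowSum, quadSplit_quad hn, map_zero, smul_zero,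
    mixedOperator_quad hjm, mul_one, implies_true, and_self]

theorem quadSpan_map [CharZero 𝕂] (hn : n ≠ 0) {a b : 𝕂} (hb : b ≠ 0) :
    (quadSpan ℓ n (0 : 𝕂) 1).map (b • LinearMap.id + a • quadSplit 𝕂 ℓ n) = quadSpan ℓ n a b := by
  have hq : ∀ i k : Fin ℓ, b • quad n 0 1 i k + a • quad n 1 0 i k = quad n a b i k := by
    intro i k
    simp only [quad, zero_smul, one_smul, zero_add, add_zero]
    rw [add_comm]
  refine le_antisymm (Submodule.map_le_iff_le_comap.2 (quadSpan_le_iff.2 ?_))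
    (quadSpan_le_iff.2 ?_)
  · simp only [Submodule.mem_comap, LinearMap.add_apply, LinearMap.smul_apply, LinearMap.id_apply,
      one_smul, quadSplit_one, quadSplit_X, quadSplit_rowSum, quadSplit_quad hn, smul_zero,
      add_zero, hq]
    exact ⟨Submodule.smul_mem _ _ (one_mem_quadSpan a b),
      fun i => Submodule.smul_mem _ _ (rowSum_mem_quadSpan a b i), smul_X_mem_quadSpan a b,
      quad_mem_quadSpan a b⟩
  · refine ⟨⟨b⁻¹ • 1, Submodule.smul_mem _ _ (one_mem_quadSpan 0 1), ?_⟩,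
      fun i => ⟨b⁻¹ • rowSum 𝕂 n i, Submodule.smul_mem _ _ (rowSum_mem_quadSpan 0 1 i), ?_⟩,
      fun s => ⟨(1 : 𝕂) • X s, smul_X_mem_quadSpan 0 1 s, ?_⟩,
      fun i k => ⟨quad n 0 1 i k, quad_mem_quadSpan 0 1 i k, ?_⟩⟩ <;>
    simp [quadSplit_one, quadSplit_X, quadSplit_rowSum, quadSplit_quad hn, hq, hb]

theorem isomorphicModules_quadSpan [CharZero 𝕂] (hn : 2 ≤ n) {a b : 𝕂} (hb : b ≠ 0) :
    IsomorphicModules (quadSpan ℓ n (0 : 𝕂) 1) (quadSpan ℓ n a b) := by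
  have hn0 : n ≠ 0 := by omega
  refine isomorphicModules_of_map (V := quadSubrep ℓ n 0 1) (W := quadSubrep ℓ n a b)
    (b • LinearMap.id + a • quadSplit 𝕂 ℓ n) (fun g v => ?_) (fun v hv h => ?_)
    (quadSpan_map hn0 hb)
  · simp only [LinearMap.add_apply, LinearMap.smul_apply, LinearMap.id_apply, quadSplit_matrixRep,
      map_add, map_smul]
  · have hjm : (⟨0, by omega⟩ : Fin n) ≠ ⟨1, by omega⟩ := by simp
    simp only [LinearMap.add_apply, LinearMap.smul_apply, LinearMap.id_apply] at h
    -- Applied to `b v + a S v = 0`, the operator kills `v` and doubles `S v`. So `a S v = 0`, and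
    -- then `b v = 0`.
    have h' := congrArg (mixedOperator 𝕂 ℓ ⟨0, by omega⟩ ⟨1, by omega⟩) h
    rw [map_add, map_smul, map_smul, mixedOperator_eq_zero hjm hv,
      mixedOperator_quadSplit hjm hv, smul_zero, zero_add, map_zero, smul_comm,
      smul_eq_zero_iff_right two_ne_zero] at h'
    rwa [h', add_zero, smul_eq_zero_iff_right hb] at h

theorem IsomorphicModules.symm {V W : Submodule 𝕂 (PolyRing 𝕂 ℓ n)} :
    IsomorphicModules V W → IsomorphicModules W V := by
  rintro ⟨V', W', hV, hW, ⟨e⟩⟩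
  exact ⟨W', V', hW, hV, ⟨e.symm⟩⟩

theorem isomorphicModules_quadSpan_self (a b : 𝕂) :
    IsomorphicModules (quadSpan ℓ n a b) (quadSpan ℓ n a b) :=
  ⟨quadSubrep ℓ n a b, quadSubrep ℓ n a b, rfl, rfl, ⟨Representation.Equiv.refl _⟩⟩

theorem polarizationModuleOf_smul [NeZero ℓ] {c : 𝕂} (hc : c ≠ 0) (f : MvPolynomial (Fin n) 𝕂) :
    polarizationModuleOf ℓ (c • f) = polarizationModuleOf ℓ f := by
  simp only [polarizationModuleOf, polarizationModule, firstRow, map_smul, Set.range_subset_iff,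
    SetLike.mem_coe, Submodule.smul_mem_iff _ hc]

end Isomorphism

/-! ### Classification of symmetric quadratic forms -/

theorem pderiv_pderiv_eq_of_isSymmetric {R σ : Type*} [CommSemiring R] {f : MvPolynomial σ R}
    (hf : f.IsSymmetric) (e : Equiv.Perm σ) (i j : σ) :
    pderiv (e i) (pderiv (e j) f) = rename e (pderiv i (pderiv j f)) := by
  rw [← pderiv_rename e.injective, ← pderiv_rename e.injective, hf e]

/-- The Hessian is constant and invariant under simultaneous permutation of its indices, so it has
one diagonal value `α` and one off-diagonal value `β`. Euler's identity, used twice, recovers `2f`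
from it. -/
theorem exists_eq_quadSymm {𝕂 : Type*} [Field 𝕂] [CharZero 𝕂] {n : ℕ}
    {f : MvPolynomial (Fin n) 𝕂} (hsymm : f.IsSymmetric) (hhom : f.IsHomogeneous 2) :
    ∃ a b : 𝕂, f = quadSymm n a b := by
  have hconst : ∀ i j, ∃ c : 𝕂, pderiv i (pderiv j f) = C c := fun i j =>
    ⟨_, totalDegree_eq_zero_iff_eq_C.1
      ((totalDegree_zero_iff_isHomogeneous _).2 (hhom.pderiv (i := j)).pderiv)⟩
  choose h hh using hconst
  have hperm : ∀ (e : Equiv.Perm (Fin n)) i j, h (e i) (e j) = h i j := fun e i j => by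
    have := pderiv_pderiv_eq_of_isSymmetric hsymm e i j
    rwa [hh, hh, rename_C, C_inj] at this
  obtain ⟨α, hα⟩ : ∃ α, ∀ i, h i i = α := by
    by_cases hn : Nonempty (Fin n)
    · obtain ⟨i₀⟩ := hn
      exact ⟨h i₀ i₀, fun i => by simpa using hperm (Equiv.swap i₀ i) i₀ i₀⟩
    · exact ⟨0, fun i => (hn ⟨i⟩).elim⟩
  obtain ⟨β, hβ⟩ : ∃ β, ∀ i j, i ≠ j → h i j = β := by
    by_cases hn : ∃ i₀ j₀ : Fin n, i₀ ≠ j₀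
    · obtain ⟨i₀, j₀, h₀⟩ := hn
      refine ⟨h i₀ j₀, fun i j hij => ?_⟩
      -- This permutation carries `(i₀, j₀)` to `(i, j)`: the inner swap fixes `i₀` and sends `j₀`
      -- to the point which the outer swap moves to `j`.
      have := hperm (Equiv.swap i₀ i * Equiv.swap j₀ (Equiv.swap i₀ i j)) i₀ j₀
      have hne : i₀ ≠ Equiv.swap i₀ i j := fun h => hij (by
        rw [eq_comm, Equiv.swap_apply_eq_iff, Equiv.swap_apply_left] at h; exact h.symm)
      rwa [Equiv.Perm.mul_apply, Equiv.Perm.mul_apply, Equiv.swap_apply_of_ne_of_ne h₀ hne,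
        Equiv.swap_apply_left, Equiv.swap_apply_left, Equiv.swap_apply_self] at this
    · exact ⟨0, fun i j hij => (hn ⟨i, j, hij⟩).elim⟩
  have hh' : ∀ i j, pderiv i (pderiv j f) = C β + if i = j then C (α - β) else 0 := fun i j => by
    rw [hh]
    by_cases hij : i = j
    · rw [if_pos hij, hij, hα, ← C_add, add_sub_cancel]
    · rw [if_neg hij, hβ i j hij, add_zero]
  have h1 : ∀ j, pderiv j f = ∑ i, X i * pderiv i (pderiv j f) := fun j => by
    rw [(hhom.pderiv (i := j)).sum_X_mul_pderiv, Nat.add_one_sub_one, one_smul]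
  have h2 : (2 : 𝕂) • f = β • psum (Fin n) 𝕂 1 ^ 2 + (α - β) • psum (Fin n) 𝕂 2 := by
    have h3 := hhom.sum_X_mul_pderiv
    rw [← Nat.cast_smul_eq_nsmul 𝕂, Nat.cast_ofNat] at h3
    rw [← h3]
    rw [Finset.sum_congr rfl fun j _ => congrArg (X j * ·) (h1 j)]
    simp only [hh']
    simp only [mul_add, Finset.sum_add_distrib, mul_ite, mul_zero, Finset.sum_ite_eq',
      Finset.mem_univ, if_true, psum, pow_one, smul_eq_C_mul, sq, Finset.mul_sum, Finset.sum_mul]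
    congr 1
    · exact Finset.sum_congr rfl fun j _ => Finset.sum_congr rfl fun i _ => by ring
    · exact Finset.sum_congr rfl fun j _ => by ring
  refine ⟨2⁻¹ * β, 2⁻¹ * (α - β), ?_⟩
  rw [quadSymm, mul_smul, mul_smul, ← smul_add, ← h2, inv_smul_smul₀ two_ne_zero]

end PolarizationModule

theorem mainTheorem7 {𝕂 : Type*} [Field 𝕂] [CharZero 𝕂] (ℓ n : ℕ) [NeZero ℓ]
    (f : MvPolynomial (Fin n) 𝕂) (hsymm : f.IsSymmetric) (hhom : f.IsHomogeneous 2)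
    (hf : f ≠ 0) :
    PolarizationModule.IsomorphicModules (PolarizationModule.polarizationModuleOf ℓ f)
        (PolarizationModule.polarizationModuleOf ℓ (MvPolynomial.psum (Fin n) 𝕂 1 ^ 2)) ∨
      PolarizationModule.IsomorphicModules (PolarizationModule.polarizationModuleOf ℓ f)
        (PolarizationModule.polarizationModuleOf ℓ (MvPolynomial.psum (Fin n) 𝕂 2)) := by
  open PolarizationModule in
  obtain ⟨a, b, rfl⟩ := exists_eq_quadSymm hsymm hhom
  have hn : n ≠ 0 := by
    rintro rfl
    exact hf (by simp [quadSymm, psum])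
  have e1 : psum (Fin n) 𝕂 1 ^ 2 = quadSymm n (1 : 𝕂) 0 := by simp [quadSymm]
  have e2 : psum (Fin n) 𝕂 2 = quadSymm n (0 : 𝕂) 1 := by simp [quadSymm]
  -- Splitting on proportionality rather than on `b = 0` also absorbs `n = 1`, where `p₁² = p₂`.
  by_cases hcase : ∃ c : 𝕂, quadSymm n a b = c • psum (Fin n) 𝕂 1 ^ 2
  · left
    obtain ⟨c, hc⟩ := hcase
    rw [hc, polarizationModuleOf_smul (by rintro rfl; exact hf (by rw [hc, zero_smul])), e1,
      polarizationModuleOf_quadSymm hn (by simp)]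
    exact isomorphicModules_quadSpan_self 1 0
  · right
    have hb : b ≠ 0 := by
      rintro rfl
      exact hcase ⟨a, by simp [quadSymm]⟩
    have hn2 : 2 ≤ n := by
      by_contra hlt
      obtain rfl : n = 1 := by omega
      exact hcase ⟨a + b, by simp [quadSymm, psum, add_smul]⟩
    -- If both vanished, subtracting would give `(n - 1) a = 0`; as `n ≥ 2`, this forces `a = 0` and
    -- then `b = 0`.
    have hab : a + b ≠ 0 ∨ n * a + b ≠ 0 := by
      by_contra! h
      have h1 : ((n : 𝕂) - 1) * a = 0 := by linear_combination h.2 - h.1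
      obtain h1 | rfl := mul_eq_zero.1 h1
      · have : (n : 𝕂) = (1 : ℕ) := by rw [Nat.cast_one]; exact sub_eq_zero.1 h1
        have := Nat.cast_injective this
        omega
      · exact hb (by simpa using h.1)
    rw [e2, polarizationModuleOf_quadSymm hn hab, polarizationModuleOf_quadSymm hn (by simp)]
    exact (isomorphicModules_quadSpan hn2 hb).symm
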